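/- Let $k\ge 4$ be an even integer and let $\chi\chi_{2k}:\mathbb{F}_2^{2k}\to\mathbb{F}_2^{2k}$ be the ChiChi mapping $y=\chi\chi_{2k}(x)$, $x=(x_0,\dots,x_{2k-1})$, $y=(y_0,\dots,y_{2k-1})$, given, with $\bar x_j:=x_j+1$, by $$ y_i=\begin{cases} x_i+\bar x_{i+1}x_{i+2}, & i<k-3 \text{ or } k<i<2k-2,\\ x_k+\bar x_{k-2}x_0, & i=k-3,\\ x_{k-1}+\bar x_0x_1, & i=k-2,\\ \bar x_{k-3}+\bar x_k\bar x_{k+1}, & i=k-1,\\ x_{k-2}+\bar x_{k+1}x_{k+2}, & i=k,\\ x_{2k-2}+\bar x_{2k-1}x_{k-1}, & i=2k-2,\\ x_{2k-1}+\bar x_{k-1}x_k, & i=2k-1. \end{cases} $$ Then $\chi\chi_{2k}$ is a permutation of $\mathbb{F}_2^{2k}$, and every non-trivial component of its inverse has algebraic degree exactly $k$: for every nonzero $c\in\mathbb{F}_2^{2k}$, the Boolean function $y\mapsto c\cdot\chi\chi_{2k}^{-1}(y)=\sum_{i=0}^{2k-1}c_i\,(\chi\chi_{2k}^{-1}(y))_i$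 has algebraic degree $k$. Here the algebraic degree of a Boolean function $f:\mathbb{F}_2^n\to\mathbb{F}_2$ is the total degree of its algebraic normal form, i.e. of the unique polynomial in $\mathbb{F}_2[y_0,\dots,y_{n-1}]$ with all individual exponents at most $1$ that represents $f$. -/

import Mathlib

/-- Every Boolean function `f : 𝔽₂ⁿ → 𝔽₂` is represented by exactly one polynomial over `𝔽₂`
in which every variable occurs with exponent at most one. -/
theorem existsUnique_anf {n : ℕ} (f : (Fin n → ZMod 2) → ZMod 2) :
    ∃! p : MvPolynomial (Fin n) (ZMod 2),
      p ∈ MvPolynomial.restrictDegree (Fin n) (ZMod 2) 1 ∧ ∀ x, MvPolynomial.eval x p = f x := by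
  have hc : Fintype.card (ZMod 2) - 1 = 1 := rfl
  have h := MvPolynomial.map_restrict_dom_evalₗ (ZMod 2) (Fin n)
  have hf : f ∈ (MvPolynomial.restrictDegree (Fin n) (ZMod 2) (Fintype.card (ZMod 2) - 1)).map
      (MvPolynomial.evalₗ (ZMod 2) (Fin n)) := by
    rw [h]; exact Submodule.mem_top
  obtain ⟨p, hp, hpf⟩ := Submodule.mem_map.1 hf
  refine ⟨p, ⟨hp, fun x => congrFun hpf x⟩, ?_⟩
  rintro q ⟨hq, hqf⟩
  refine sub_eq_zero.1 (MvPolynomial.eq_zero_of_eval_eq_zero (Fin n) (ZMod 2) (q - p) ?_ ?_)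
  · intro v
    rw [map_sub, hqf v, ← congrFun hpf v]
    exact sub_self _
  · exact Submodule.sub_mem _ hq hp

/-- The algebraic normal form of a Boolean function `f : 𝔽₂ⁿ → 𝔽₂`: the unique polynomial with
all exponents at most one that represents `f`. -/
noncomputable def anf {n : ℕ} (f : (Fin n → ZMod 2) → ZMod 2) : MvPolynomial (Fin n) (ZMod 2) :=
  (existsUnique_anf f).choose

/-- The algebraic degree of a Boolean function: the total degree of its algebraic normal form. -/
noncomputable def algebraicDegree {n : ℕ} (f : (Fin n → ZMod 2) → ZMod 2) : ℕ :=
  (anf f).totalDegree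

theorem anf_eq {n : ℕ} {f : (Fin n → ZMod 2) → ZMod 2} {p : MvPolynomial (Fin n) (ZMod 2)}
    (hp : p ∈ MvPolynomial.restrictDegree (Fin n) (ZMod 2) 1)
    (hf : ∀ x, MvPolynomial.eval x p = f x) : anf f = p :=
  ((existsUnique_anf f).choose_spec.2 p ⟨hp, hf⟩).symm

/-- The component function of `F : 𝔽₂ⁿ → 𝔽₂ⁿ` with mask `c`, namely `x ↦ c · F x` with the
standard inner product. It is non-trivial when `c ≠ 0`. -/
def componentFunction {n : ℕ} (F : (Fin n → ZMod 2) → (Fin n → ZMod 2)) (c : Fin n → ZMod 2) :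
    (Fin n → ZMod 2) → ZMod 2 :=
  fun x => c ⬝ᵥ F x

/-- The ChiChi mapping on `𝔽₂^(2k)`, coordinates indexed by `0, …, 2k - 1`. The cases are those
of the usual definition, `i < k - 3`, `k < i < 2k - 2`, `i = k - 3`, `i = k - 2`, `i = k - 1`,
`i = k`, `i = 2k - 2` and `i = 2k - 1`, and `x + 1` is the complement of the bit `x`. -/
def chiChi (k : ℕ) (hk : 4 ≤ k) (x : Fin (2 * k) → ZMod 2) : Fin (2 * k) → ZMod 2 := fun i =>
  if h : i.val < k - 3 ∨ (k < i.val ∧ i.val < 2 * k - 2) then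
    x i + (x ⟨i.val + 1, by omega⟩ + 1) * x ⟨i.val + 2, by omega⟩
  else if i.val = k - 3 then
    x ⟨k, by omega⟩ + (x ⟨k - 2, by omega⟩ + 1) * x ⟨0, by omega⟩
  else if i.val = k - 2 then
    x ⟨k - 1, by omega⟩ + (x ⟨0, by omega⟩ + 1) * x ⟨1, by omega⟩
  else if i.val = k - 1 then
    (x ⟨k - 3, by omega⟩ + 1) + (x ⟨k, by omega⟩ + 1) * (x ⟨k + 1, by omega⟩ + 1)
  else if i.val = k then
    x ⟨k - 2, by omega⟩ + (x ⟨k + 1, by omega⟩ + 1) * x ⟨k + 2, by omega⟩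
  else if i.val = 2 * k - 2 then
    x ⟨2 * k - 2, by omega⟩ + (x ⟨2 * k - 1, by omega⟩ + 1) * x ⟨k - 1, by omega⟩
  else
    x ⟨2 * k - 1, by omega⟩ + (x ⟨k - 1, by omega⟩ + 1) * x ⟨k, by omega⟩

open Finset

theorem coeff_anf {n : ℕ} (f : (Fin n → ZMod 2) → ZMod 2) (d : Fin n →₀ ℕ) (hd : ∀ i, d i ≤ 1) :
    (anf f).coeff d = ∑ y, f y * ∏ i, (if d i = 0 then y i + 1 else 1) := by
  obtain ⟨⟨hres, heval⟩, -⟩ := (existsUnique_anf f).choose_spec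
  change anf f ∈ _ at hres
  change ∀ x, MvPolynomial.eval x (anf f) = f x at heval
  rw [MvPolynomial.mem_restrictDegree] at hres
  have key : ∀ e ∈ (anf f).support,
      ∑ y : Fin n → ZMod 2, (∏ i, y i ^ e i) * ∏ i, (if d i = 0 then y i + 1 else 1) =
        if d = e then 1 else 0 := by
    intro e he
    simp_rw [← prod_mul_distrib]
    rw [← Fintype.prod_sum (fun i (t : ZMod 2) => t ^ e i * (if d i = 0 then t + 1 else 1))]
    have hi : ∀ i, ∑ t : ZMod 2, t ^ e i * (if d i = 0 then t + 1 else 1) =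
        if d i = e i then 1 else 0 := by
      intro i
      have h1 := hd i
      have h2 := hres e he i
      generalize d i = a at *
      generalize e i = b at *
      interval_cases a <;> interval_cases b <;> decide
    simp_rw [hi]
    split_ifs with h
    · subst h; simp
    · obtain ⟨i, hne⟩ := DFunLike.ne_iff.1 h
      exact prod_eq_zero (mem_univ i) (if_neg hne)
  simp_rw [← heval, MvPolynomial.eval_eq', sum_mul]
  rw [sum_comm]
  simp_rw [mul_assoc, ← mul_sum]
  rw [sum_congr rfl fun e he => by rw [key e he]]
  simp

theorem sum_mul_eval_eq_zero_of_algebraicDegree_lt {n m : ℕ} {f : (Fin n → ZMod 2) → ZMod 2}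
    (hf : algebraicDegree f < m) (G : MvPolynomial (Fin n) (ZMod 2)) (hG : G.totalDegree + m ≤ n) :
    ∑ y, f y * MvPolynomial.eval y G = 0 := by
  obtain ⟨⟨-, heval⟩, -⟩ := (existsUnique_anf f).choose_spec
  change ∀ x, MvPolynomial.eval x (anf f) = f x at heval
  simp_rw [← heval, ← map_mul]
  apply MvPolynomial.sum_eval_eq_zero
  have := MvPolynomial.totalDegree_mul (anf f) G
  change (anf f).totalDegree < m at hf
  simp [ZMod.card]
  omega

/-- A permutation with coordinates of degree at most two has an inverse whose components have
algebraic degree at most half the dimension. -/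
theorem algebraicDegree_component_symm_le {k : ℕ} (e : Equiv.Perm (Fin (2 * k) → ZMod 2))
    (P : Fin (2 * k) → MvPolynomial (Fin (2 * k)) (ZMod 2)) (hP : ∀ i, (P i).totalDegree ≤ 2)
    (heval : ∀ x i, MvPolynomial.eval x (P i) = e x i) (c : Fin (2 * k) → ZMod 2) :
    algebraicDegree (componentFunction e.symm c) ≤ k := by
  obtain ⟨⟨hres, -⟩, -⟩ := (existsUnique_anf (componentFunction e.symm c)).choose_spec
  change anf _ ∈ _ at hres
  rw [MvPolynomial.mem_restrictDegree] at hres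
  refine Finset.sup_le fun d hd => ?_
  by_contra! hlt
  have h1 : ∀ i, d i ≤ 1 := hres d hd
  refine MvPolynomial.mem_support_iff.1 hd ?_
  rw [coeff_anf _ _ h1, ← Equiv.sum_comp e]
  set Z : Finset (Fin (2 * k)) := univ.filter fun i => d i = 0 with hZ
  let G : MvPolynomial (Fin (2 * k)) (ZMod 2) :=
    (∑ i, MvPolynomial.C (c i) * MvPolynomial.X i) * ∏ i ∈ Z, (P i + 1)
  have hG : ∀ x, componentFunction e.symm c (e x) * ∏ i, (if d i = 0 then e x i + 1 else 1) =
      MvPolynomial.eval x G := by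
    intro x
    simp only [G, componentFunction, dotProduct, hZ, prod_filter, map_mul, map_sum,
      MvPolynomial.eval_prod, apply_ite (MvPolynomial.eval x), map_add, map_one, heval,
      Equiv.symm_apply_apply, MvPolynomial.eval_C, MvPolynomial.eval_X]
  simp_rw [hG]
  apply MvPolynomial.sum_eval_eq_zero
  have hsum : (d.sum fun _ a => a) + #Z = 2 * k := by
    rw [Finsupp.sum_fintype _ _ (by simp), hZ, card_filter, ← sum_add_distrib]
    rw [sum_congr rfl (g := fun _ => 1)]
    · simp
    · intro i _
      have := h1 i
      split_ifs <;> omega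
  have hdeg : G.totalDegree ≤ 1 + #Z * 2 := by
    refine (MvPolynomial.totalDegree_mul _ _).trans (add_le_add ?_ ?_)
    · refine MvPolynomial.totalDegree_finsetSum_le fun i _ => ?_
      refine (MvPolynomial.totalDegree_mul _ _).trans ?_
      simp
    · refine (MvPolynomial.totalDegree_finsetProd _ _).trans ?_
      refine (sum_le_card_nsmul _ _ 2 fun i _ => ?_).trans_eq (by simp)
      refine (MvPolynomial.totalDegree_add _ _).trans (max_le (hP i) (by simp))
  simp [ZMod.card]
  omega

section Fibre

variable {k : ℕ} (e : Equiv.Perm (Fin (2 * k) → ZMod 2)) (T : Finset (Fin (2 * k)))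
  (pt : Fin (2 * k) → ZMod 2)

theorem sum_fibre_eq_zero {c : Fin (2 * k) → ZMod 2}
    (hc : algebraicDegree (componentFunction e.symm c) < k) (hT : #T ≤ k) :
    ∑ x with ∀ i ∈ T, e x i = e pt i, c ⬝ᵥ x = 0 := by
  have h := sum_mul_eval_eq_zero_of_algebraicDegree_lt hc
    (∏ i ∈ T, (MvPolynomial.X i + MvPolynomial.C (e pt i + 1))) (by
      have : (∏ i ∈ T, (MvPolynomial.X i + MvPolynomial.C (e pt i + 1)) :
          MvPolynomial (Fin (2 * k)) (ZMod 2)).totalDegree ≤ #T := by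
        refine (MvPolynomial.totalDegree_finsetProd _ _).trans ?_
        refine (sum_le_card_nsmul _ _ 1 fun i _ => ?_).trans_eq (by simp)
        refine (MvPolynomial.totalDegree_add _ _).trans (max_le (by simp) ?_)
        rw [MvPolynomial.totalDegree_C]
        exact zero_le_one
      omega)
  rw [← Equiv.sum_comp e] at h
  rw [sum_filter]
  refine (sum_congr rfl fun x _ => ?_).trans h
  have h01 : ∀ a b : ZMod 2, a + (b + 1) = if a = b then 1 else 0 := by decide
  simp only [MvPolynomial.eval_prod, map_add, MvPolynomial.eval_X, MvPolynomial.eval_C, h01,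
    componentFunction, Equiv.symm_apply_apply]
  split_ifs with hx
  · rw [prod_congr rfl fun i hi => if_pos (hx i hi)]
    simp
  · push Not at hx
    obtain ⟨i, hi, hne⟩ := hx
    rw [prod_eq_zero hi (if_neg hne), mul_zero]

theorem four_dvd_card_fibre (hk : 2 ≤ k) (hT : #T ≤ k) :
    4 ∣ #{x | ∀ i ∈ T, e x i = e pt i} := by
  have h1 : #{x | ∀ i ∈ T, e x i = e pt i} =
      #(Fintype.piFinset fun i => if i ∈ T then {e pt i} else (univ : Finset (ZMod 2))) := by
    refine card_bij (fun x _ => e x) ?_ (fun _ _ _ _ h => e.injective h) ?_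
    · intro x hx
      rw [Fintype.mem_piFinset]
      intro i
      split_ifs with hi
      · simpa using (mem_filter.1 hx).2 i hi
      · exact mem_univ _
    · intro y hy
      refine ⟨e.symm y, ?_, by simp⟩
      rw [Fintype.mem_piFinset] at hy
      rw [mem_filter]
      refine ⟨mem_univ _, fun i hi => ?_⟩
      have := hy i
      rw [if_pos hi] at this
      simpa using this
  rw [h1, Fintype.card_piFinset]
  simp_rw [apply_ite card]
  rw [prod_ite]
  simp only [card_singleton, prod_const_one, one_mul, prod_const, card_univ, ZMod.card]
  have h2 := card_filter_add_card_filter_not (s := univ) fun i : Fin (2 * k) => i ∈ T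
  simp only [filter_univ_mem, card_univ, Fintype.card_fin] at h2
  exact pow_dvd_pow 2 (by omega : 2 ≤ _)

end Fibre

theorem sum_eq_of_eq_off_point {α : Type*} {V : Finset α} {h : α → ZMod 2} {K : ZMod 2}
    {p : α} (hV : 2 ∣ #V) (hp : p ∈ V) (hh : ∀ x ∈ V, x ≠ p → h x = K) : ∑ x ∈ V, h x = h p - K := by
  have h2 : ∑ x ∈ V, K = 0 := by
    obtain ⟨m, hm⟩ := hV
    have : (2 : ZMod 2) = 0 := rfl
    simp [hm, this]
  rw [← sub_zero (∑ x ∈ V, h x), ← h2, ← sum_sub_distrib,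
    sum_eq_single_of_mem p hp fun x hx hne => by rw [hh x hx hne, sub_self]]

theorem dotProduct_flip_eq {n : ℕ} {V : Finset (Fin n → ZMod 2)} {c : Fin n → ZMod 2}
    (h4 : 4 ∣ #V) (hsum : ∑ x ∈ V, c ⬝ᵥ x = 0) (D : (Fin n → ZMod 2) → Fin n → ZMod 2) (v : Fin n)
    {p : Fin n → ZMod 2} (hp : p ∈ V) (hpv : p v = 0) (hmem : ∀ x ∈ V, x + D x ∈ V)
    (hD : ∀ x ∈ V, D (x + D x) = D x) (hv : ∀ x ∈ V, D x v = 1)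
    (hne : ∀ x ∈ V, x v = 0 → x ≠ p → c ⬝ᵥ D x = c v) : c ⬝ᵥ D p = c v := by
  have hxx : ∀ x : Fin n → ZMod 2, x + x = 0 := fun x => funext fun i => CharTwo.add_self_eq_zero _
  have h01 : ∀ a : ZMod 2, ¬ a = 0 ↔ a + 1 = 0 := by decide
  have h11 : ∀ a : ZMod 2, ¬ a + 1 = 0 ↔ a = 0 := by decide
  have hinv : ∀ x ∈ V, x + D x + D (x + D x) = x := fun x hx => by
    rw [hD x hx, add_assoc, hxx, add_zero]
  have hval : ∀ x ∈ V, (x + D x) v = x v + 1 := fun x hx => by rw [Pi.add_apply, hv x hx]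
  have hcard : #{x ∈ V | ¬ x v = 0} = #{x ∈ V | x v = 0} := by
    refine card_bij' (fun x _ => x + D x) (fun x _ => x + D x) ?_ ?_ ?_ ?_
    · intro x hx
      rw [mem_filter] at hx ⊢
      exact ⟨hmem x hx.1, by rw [hval x hx.1, ← h01]; exact hx.2⟩
    · intro x hx
      rw [mem_filter] at hx ⊢
      exact ⟨hmem x hx.1, by rw [hval x hx.1, h11]; exact hx.2⟩
    · exact fun x hx => hinv x (mem_filter.1 hx).1
    · exact fun x hx => hinv x (mem_filter.1 hx).1
  have hflip : ∑ x ∈ V with ¬ x v = 0, c ⬝ᵥ x = ∑ x ∈ V with x v = 0, c ⬝ᵥ (x + D x) := by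
    refine sum_bij' (fun x _ => x + D x) (fun x _ => x + D x) ?_ ?_ ?_ ?_ ?_
    · intro x hx
      rw [mem_filter] at hx ⊢
      exact ⟨hmem x hx.1, by rw [hval x hx.1, ← h01]; exact hx.2⟩
    · intro x hx
      rw [mem_filter] at hx ⊢
      exact ⟨hmem x hx.1, by rw [hval x hx.1, h11]; exact hx.2⟩
    · exact fun x hx => hinv x (mem_filter.1 hx).1
    · exact fun x hx => hinv x (mem_filter.1 hx).1
    · exact fun x hx => by rw [hinv x (mem_filter.1 hx).1]
  have hsplit := card_filter_add_card_filter_not (s := V) fun x => x v = 0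
  have heven : 2 ∣ #{x ∈ V | x v = 0} := by omega
  have hS := sum_filter_add_sum_filter_not V (fun x => x v = 0) fun x => c ⬝ᵥ x
  rw [hflip, hsum, ← sum_add_distrib] at hS
  have hS' : ∑ x ∈ V with x v = 0, c ⬝ᵥ D x = 0 := by
    refine (sum_congr rfl fun x _ => ?_).trans hS
    rw [dotProduct_add, ← add_assoc, CharTwo.add_self_eq_zero, zero_add]
  rw [sum_eq_of_eq_off_point heven (mem_filter.2 ⟨hp, hpv⟩) (K := c v) (fun x hx hxp => by
    rw [mem_filter] at hx; exact hne x hx.1 hx.2 hxp)] at hS'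
  exact sub_eq_zero.1 hS'

/-- The two ChiChi cycles listed as one sequence: `chiVar k hk m` is the coordinate at
position `m`. -/
def chiVar (k : ℕ) (hk : 4 ≤ k) (m : ℕ) : Fin (2 * k) :=
  ⟨if m = 0 then k - 2 else if m < k then k + m else if m = k then k - 1
    else if m < 2 * k - 1 then m - (k + 1) else k, by split_ifs <;> omega⟩

/-- The position of a coordinate in the sequence enumerated by `chiVar`. -/
def chiPos (k i : ℕ) : ℕ :=
  if i < k - 2 then i + (k + 1) else if i = k - 2 then 0 else if i = k - 1 then k
    else if i = k then 2 * k - 1 else i - k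

/-- The output index of the ChiChi equation whose linear variable is at position `m`. -/
def chiOut (k : ℕ) (hk : 4 ≤ k) (m : ℕ) : Fin (2 * k) :=
  ⟨if m < k then k + m else if m = k then k - 2 else if m < 2 * k - 2 then m - (k + 1)
    else if m = 2 * k - 2 then k - 1 else k - 3, by split_ifs <;> omega⟩

/-- The position of the complemented factor in the equation at position `p`. -/
def chiFst (k p : ℕ) : ℕ := if p = 2 * k - 1 then 0 else p + 1

/-- The position of the second factor in the equation at position `p`. -/
def chiSnd (k p : ℕ) : ℕ :=
  if p = k - 1 then 2 * k - 1 else if p = 2 * k - 3 then 0 else if p = 2 * k - 2 then 1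
    else if p = 2 * k - 1 then k + 1 else p + 2

/-- The complementation of the second factor in the equation at position `p`. -/
def chiCompl (k p : ℕ) : ZMod 2 := if p = 2 * k - 2 then 1 else 0

/-- The ChiChi equations in the order of positions. -/
def chiEqn (k : ℕ) (z : ℕ → ZMod 2) (p : ℕ) : ZMod 2 :=
  z p + (z (chiFst k p) + 1) * (z (chiSnd k p) + chiCompl k p)

variable {k : ℕ} {hk : 4 ≤ k}

theorem chiPos_lt (hk : 4 ≤ k) (i : Fin (2 * k)) : chiPos k i < 2 * k := by
  unfold chiPos; split_ifs <;> omega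

theorem chiVar_chiPos (i : Fin (2 * k)) : chiVar k hk (chiPos k i) = i := by
  ext; simp only [chiVar, chiPos]; split_ifs <;> first | omega | contradiction

theorem chiPos_chiVar {m : ℕ} (hm : m < 2 * k) : chiPos k (chiVar k hk m) = m := by
  simp only [chiVar, chiPos]; split_ifs <;> omega

theorem chiVar_inj {m n : ℕ} (hm : m < 2 * k) (hn : n < 2 * k)
    (h : chiVar k hk m = chiVar k hk n) : m = n := by
  rw [← chiPos_chiVar (hk := hk) hm, h, chiPos_chiVar hn]

theorem chiOut_surjective (i : Fin (2 * k)) : ∃ m < 2 * k, chiOut k hk m = i := by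
  refine ⟨if i.val < k - 3 then i + (k + 1) else if i.val = k - 3 then 2 * k - 1
    else if i.val = k - 2 then k else if i.val = k - 1 then 2 * k - 2 else i - k, ?_, ?_⟩
  · split_ifs <;> omega
  · ext; simp only [chiOut]; split_ifs <;> omega

theorem chiFst_lt (hk : 4 ≤ k) {p : ℕ} (hp : p < 2 * k) : chiFst k p < 2 * k := by
  unfold chiFst; split_ifs <;> omega

theorem chiSnd_lt (hk : 4 ≤ k) {p : ℕ} (hp : p < 2 * k) : chiSnd k p < 2 * k := by
  unfold chiSnd; split_ifs <;> omega

theorem chiVar_val_zero : (chiVar k hk 0 : ℕ) = k - 2 := rfl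

theorem chiVar_val_of_lt {m : ℕ} (h0 : 0 < m) (h : m < k) : (chiVar k hk m : ℕ) = k + m := by
  simp only [chiVar]; split_ifs <;> omega

theorem chiVar_val_self : (chiVar k hk k : ℕ) = k - 1 := by
  simp only [chiVar]; split_ifs <;> omega

theorem chiVar_val_of_gt {m : ℕ} (h : k < m) (h' : m < 2 * k - 1) :
    (chiVar k hk m : ℕ) = m - (k + 1) := by
  simp only [chiVar]; split_ifs <;> omega

theorem chiVar_val_last {m : ℕ} (h : m = 2 * k - 1) : (chiVar k hk m : ℕ) = k := by
  simp only [chiVar]; split_ifs <;> omega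

theorem chiOut_val_of_lt {m : ℕ} (h : m < k) : (chiOut k hk m : ℕ) = k + m := by
  simp only [chiOut]; split_ifs <;> omega

theorem chiOut_val_of_gt {m : ℕ} (h : k < m) (h' : m < 2 * k - 2) :
    (chiOut k hk m : ℕ) = m - (k + 1) := by
  simp only [chiOut]; split_ifs <;> omega

theorem chiEqn_of_val {x : Fin (2 * k) → ZMod 2} {p : ℕ} {t a b : Fin (2 * k)}
    (h0 : p ≠ 2 * k - 2) (ht : (chiVar k hk p : ℕ) = t) (ha : (chiVar k hk (chiFst k p) : ℕ) = a)
    (hb : (chiVar k hk (chiSnd k p) : ℕ) = b) :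
    x t + (x a + 1) * x b = chiEqn k (x ∘ chiVar k hk) p + chiCompl k p := by
  rw [← Fin.ext ht, ← Fin.ext ha, ← Fin.ext hb]
  simp [chiEqn, chiCompl, h0]

theorem chiFst_eq {p : ℕ} (h : p ≠ 2 * k - 1) : chiFst k p = p + 1 := if_neg h

theorem chiFst_last : chiFst k (2 * k - 1) = 0 := if_pos rfl

theorem chiSnd_eq {p : ℕ} (h : p < 2 * k - 3) (h' : p ≠ k - 1) : chiSnd k p = p + 2 := by
  unfold chiSnd; split_ifs <;> omega

theorem chiSnd_pred : chiSnd k (k - 1) = 2 * k - 1 := if_pos rfl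

theorem chiSnd_sub_three (hk : 4 ≤ k) : chiSnd k (2 * k - 3) = 0 := by
  unfold chiSnd; split_ifs <;> omega

theorem chiSnd_sub_two (hk : 4 ≤ k) : chiSnd k (2 * k - 2) = 1 := by
  unfold chiSnd; split_ifs <;> omega

theorem chiSnd_last (hk : 4 ≤ k) : chiSnd k (2 * k - 1) = k + 1 := by
  unfold chiSnd; split_ifs <;> omega

theorem chiChi_chiOut (x : Fin (2 * k) → ZMod 2) {p : ℕ} (hp : p < 2 * k) :
    chiChi k hk x (chiOut k hk p) = chiEqn k (x ∘ chiVar k hk) p + chiCompl k p := by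
  rcases (by omega : p = 0 ∨ (0 < p ∧ p < k - 2) ∨ p = k - 2 ∨ p = k - 1 ∨ p = k ∨
    (k < p ∧ p < 2 * k - 3) ∨ p = 2 * k - 3 ∨ p = 2 * k - 2 ∨ p = 2 * k - 1) with
    rfl | ⟨h, h'⟩ | rfl | rfl | rfl | ⟨h, h'⟩ | rfl | rfl | rfl
  · have e := chiOut_val_of_lt (hk := hk) (m := 0) (by omega)
    unfold chiChi
    rw [dif_neg (by omega), if_neg (by omega), if_neg (by omega), if_neg (by omega),
      if_pos (by omega)]
    refine chiEqn_of_val (by omega) rfl ?_ ?_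
    · rw [chiFst_eq (by omega), chiVar_val_of_lt (by omega) (by omega)]
    · rw [chiSnd_eq (by omega) (by omega), chiVar_val_of_lt (by omega) (by omega)]
  · have e := chiOut_val_of_lt (hk := hk) (m := p) (by omega)
    unfold chiChi
    rw [dif_pos (by omega)]
    refine chiEqn_of_val (by omega) ?_ ?_ ?_
    · rw [chiVar_val_of_lt (by omega) (by omega), e]
    · rw [chiFst_eq (by omega), chiVar_val_of_lt (by omega) (by omega)]
      simp only [e]; omega
    · rw [chiSnd_eq (by omega) (by omega), chiVar_val_of_lt (by omega) (by omega)]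
      simp only [e]; omega
  · have e := chiOut_val_of_lt (hk := hk) (m := k - 2) (by omega)
    unfold chiChi
    rw [dif_neg (by omega), if_neg (by omega), if_neg (by omega), if_neg (by omega),
      if_neg (by omega), if_pos (by omega)]
    refine chiEqn_of_val (by omega) ?_ ?_ ?_
    · rw [chiVar_val_of_lt (by omega) (by omega)]
      simp only; omega
    · rw [chiFst_eq (by omega), chiVar_val_of_lt (by omega) (by omega)]
      simp only; omega
    · rw [chiSnd_eq (by omega) (by omega), show k - 2 + 2 = k by omega, chiVar_val_self]
  · have e := chiOut_val_of_lt (hk := hk) (m := k - 1) (by omega)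
    unfold chiChi
    rw [dif_neg (by omega), if_neg (by omega), if_neg (by omega), if_neg (by omega),
      if_neg (by omega), if_neg (by omega)]
    refine chiEqn_of_val (by omega) ?_ ?_ ?_
    · rw [chiVar_val_of_lt (by omega) (by omega)]
      simp only; omega
    · rw [chiFst_eq (by omega), show k - 1 + 1 = k by omega, chiVar_val_self]
    · rw [chiSnd_pred, chiVar_val_last rfl]
  · have e : (chiOut p hk p : ℕ) = p - 2 := by
      simp only [chiOut]; split_ifs <;> omega
    unfold chiChi
    rw [dif_neg (by omega), if_neg (by omega), if_pos (by omega)]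
    refine chiEqn_of_val (by omega) chiVar_val_self ?_ ?_
    · rw [chiFst_eq (by omega), chiVar_val_of_gt (by omega) (by omega)]
      simp only; omega
    · rw [chiSnd_eq (by omega) (by omega), chiVar_val_of_gt (by omega) (by omega)]
      simp only; omega
  · have e := chiOut_val_of_gt (hk := hk) (m := p) (by omega) (by omega)
    unfold chiChi
    rw [dif_pos (by omega)]
    refine chiEqn_of_val (by omega) ?_ ?_ ?_
    · rw [chiVar_val_of_gt (by omega) (by omega), e]
    · rw [chiFst_eq (by omega), chiVar_val_of_gt (by omega) (by omega)]
      simp only [e]; omega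
    · rw [chiSnd_eq (by omega) (by omega), chiVar_val_of_gt (by omega) (by omega)]
      simp only [e]; omega
  · have e := chiOut_val_of_gt (hk := hk) (m := 2 * k - 3) (by omega) (by omega)
    unfold chiChi
    rw [dif_pos (by omega)]
    refine chiEqn_of_val (by omega) ?_ ?_ ?_
    · rw [chiVar_val_of_gt (by omega) (by omega), e]
    · rw [chiFst_eq (by omega), chiVar_val_of_gt (by omega) (by omega)]
      simp only [e]; omega
    · rw [chiSnd_sub_three hk, chiVar_val_zero]
      simp only [e]; omega
  · have e : (chiOut k hk (2 * k - 2) : ℕ) = k - 1 := by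
      simp only [chiOut]; split_ifs <;> omega
    unfold chiChi
    rw [dif_neg (by omega), if_neg (by omega), if_neg (by omega), if_pos (by omega)]
    have h1 : (⟨k - 3, by omega⟩ : Fin (2 * k)) = chiVar k hk (2 * k - 2) :=
      Fin.ext (by rw [chiVar_val_of_gt (by omega) (by omega)]; simp only; omega)
    have h2 : (⟨k, by omega⟩ : Fin (2 * k)) = chiVar k hk (2 * k - 1) :=
      Fin.ext (by rw [chiVar_val_last rfl])
    have h3 : (⟨k + 1, by omega⟩ : Fin (2 * k)) = chiVar k hk 1 :=
      Fin.ext (by rw [chiVar_val_of_lt (by omega) (by omega)])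
    rw [h1, h2, h3, chiEqn, chiSnd_sub_two hk, chiFst_eq (by omega),
      show 2 * k - 2 + 1 = 2 * k - 1 by omega, chiCompl, if_pos rfl, add_right_comm]
    rfl
  · have e : (chiOut k hk (2 * k - 1) : ℕ) = k - 3 := by
      simp only [chiOut]; split_ifs <;> omega
    unfold chiChi
    rw [dif_neg (by omega), if_pos (by omega)]
    refine chiEqn_of_val (by omega) (chiVar_val_last rfl) ?_ ?_
    · rw [chiFst_last, chiVar_val_zero]
    · rw [chiSnd_last hk, chiVar_val_of_gt (by omega) (by omega)]
      simp only; omega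

section Injective

variable {k : ℕ} {z w : ℕ → ZMod 2}

theorem eq_chiEqn_add (hk : 4 ≤ k) {i : ℕ} (hi : i + 4 ≤ 2 * k) (hi' : i ≠ k - 1) :
    z i = chiEqn k z i + (chiEqn k z (i + 1) + 1) * z (i + 2) := by
  have h : ∀ a b c r : ZMod 2, a = a + (b + 1) * (c + 0) + (b + (c + 1) * r + 1) * c := by decide
  have h1 : chiEqn k z i = z i + (z (i + 1) + 1) * (z (i + 2) + 0) := by
    rw [chiEqn, chiFst_eq (by omega), chiSnd_eq (by omega) hi', chiCompl, if_neg (by omega)]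
  rw [h1, chiEqn, chiFst_eq (p := i + 1) (by omega)]
  exact h _ _ _ _

theorem chiEqn_pred (hk : 4 ≤ k) :
    chiEqn k z (k - 1) = z (k - 1) + (z k + 1) * z (2 * k - 1) := by
  rw [chiEqn, chiFst_eq (by omega), chiSnd_pred, chiCompl, if_neg (by omega), add_zero,
    Nat.sub_add_cancel (by omega)]

theorem chiEqn_sub_three (hk : 4 ≤ k) :
    chiEqn k z (2 * k - 3) = z (2 * k - 3) + (z (2 * k - 2) + 1) * z 0 := by
  rw [chiEqn, chiFst_eq (by omega), chiSnd_sub_three hk, chiCompl, if_neg (by omega), add_zero,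
    show 2 * k - 3 + 1 = 2 * k - 2 by omega]

theorem chiEqn_sub_two (hk : 4 ≤ k) :
    chiEqn k z (2 * k - 2) = z (2 * k - 2) + (z (2 * k - 1) + 1) * (z 1 + 1) := by
  rw [chiEqn, chiFst_eq (by omega), chiSnd_sub_two hk, chiCompl, if_pos rfl,
    show 2 * k - 2 + 1 = 2 * k - 1 by omega]

theorem chiEqn_last (hk : 4 ≤ k) :
    chiEqn k z (2 * k - 1) = z (2 * k - 1) + (z 0 + 1) * z (k + 1) := by
  rw [chiEqn, chiFst_last, chiSnd_last hk, chiCompl, if_neg (by omega), add_zero]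

/-- If the values at the odd positions and the starting bit vanish, then so does the upper
half of the odd chain. -/
theorem eq_zero_of_chiEqn_odd (hk : 4 ≤ k) (hke : Even k)
    (hodd : ∀ i, i + 3 ≤ 2 * k → i % 2 = 1 → chiEqn k z i = 0) (h0 : z 0 = 0) :
    z (k + 1) = 0 := by
  have hk2 : k % 2 = 0 := Nat.even_iff.1 hke
  have key : ∀ m i, i + 2 * m = 2 * k - 3 → k < i → z i = 0 := by
    intro m
    induction m with
    | zero =>
      rintro i rfl -
      have := hodd (2 * k - 3) (by omega) (by omega)
      rw [chiEqn_sub_three hk, h0] at this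
      simpa using this
    | succ m ih =>
      intro i hi ha
      rw [eq_chiEqn_add hk (z := z) (i := i) (by omega) (by omega), hodd i (by omega) (by omega),
        ih (i + 2) (by omega) (by omega), mul_zero, add_zero]
  exact key ((2 * k - 3 - (k + 1)) / 2) _ (by omega) (by omega)

variable (h : ∀ p < 2 * k, chiEqn k z p = chiEqn k w p)
include h

theorem chiEqn_agree_down (hk : 4 ≤ k) {a b : ℕ} (hb : b + 2 ≤ 2 * k)
    (hok : ∀ i, a ≤ i → i + 2 ≤ b → i % 2 = b % 2 → i ≠ k - 1) (hzw : z b = w b) :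
    ∀ i, a ≤ i → i ≤ b → i % 2 = b % 2 → z i = w i := by
  have key : ∀ m i, i + 2 * m = b → a ≤ i → z i = w i := by
    intro m
    induction m with
    | zero => rintro i rfl -; exact hzw
    | succ m ih =>
      intro i hi ha
      have hne := hok i ha (by omega) (by omega)
      rw [eq_chiEqn_add hk (z := z) (by omega) hne, eq_chiEqn_add hk (z := w) (by omega) hne,
        h _ (by omega), h _ (by omega), ih (i + 2) (by omega) (by omega)]
  intro i ha hib hpar
  exact key ((b - i) / 2) i (by omega) ha

theorem chiEqn_injOn (hk : 4 ≤ k) (hke : Even k) : ∀ p < 2 * k, z p = w p := by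
  have hk2 : k % 2 = 0 := Nat.even_iff.1 hke
  have e1 := h (k - 1) (by omega)
  have e2 := h (2 * k - 3) (by omega)
  have e3 := h (2 * k - 2) (by omega)
  have e4 := h (2 * k - 1) (by omega)
  rw [chiEqn_pred hk, chiEqn_pred hk] at e1
  rw [chiEqn_sub_three hk, chiEqn_sub_three hk] at e2
  rw [chiEqn_sub_two hk, chiEqn_sub_two hk] at e3
  rw [chiEqn_last hk, chiEqn_last hk] at e4
  by_cases htop : z (2 * k - 2) = w (2 * k - 2)
  · have heven := chiEqn_agree_down h hk (a := 0) (b := 2 * k - 2) (by omega)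
      (fun i _ _ _ => by omega) htop
    rw [htop, heven 0 le_rfl (by omega) (by omega)] at e2
    have hupper := chiEqn_agree_down h hk (a := k + 1) (b := 2 * k - 3) (by omega)
      (fun i _ _ _ => by omega) (add_right_cancel e2)
    rw [heven 0 le_rfl (by omega) (by omega), hupper (k + 1) le_rfl (by omega) (by omega)] at e4
    have hs := add_right_cancel e4
    rw [hs, heven k (by omega) (by omega) (by omega)] at e1
    have hlower := chiEqn_agree_down h hk (a := 1) (b := k - 1) (by omega)
      (fun i _ _ _ => by omega) (add_right_cancel e1)
    intro p hp
    rcases (by omega : p = 2 * k - 1 ∨ (p ≤ 2 * k - 2 ∧ p % 2 = 0) ∨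
      (1 ≤ p ∧ p ≤ k - 1 ∧ p % 2 = 1) ∨ (k + 1 ≤ p ∧ p ≤ 2 * k - 3 ∧ p % 2 = 1)) with
      rfl | ⟨h1, h2⟩ | ⟨h1, h2, h3⟩ | ⟨h1, h2, h3⟩
    · exact hs
    · exact heven p (by omega) h1 (by omega)
    · exact hlower p h1 h2 (by omega)
    · exact hupper p h1 h2 (by omega)
  exfalso
  have hs : z (2 * k - 1) ≠ w (2 * k - 1) := by
    intro hs
    rw [← hs] at e3 e1
    rcases (by decide : ∀ a : ZMod 2, a = 0 ∨ a + 1 = 0) (z (2 * k - 1)) with h0 | h0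
    · rw [h0, mul_zero, mul_zero, add_zero, add_zero] at e1
      have hlower := chiEqn_agree_down h hk (a := 1) (b := k - 1) (by omega)
        (fun i _ _ _ => by omega) e1
      rw [hlower 1 le_rfl (by omega) (by omega)] at e3
      exact htop (add_right_cancel e3)
    · rw [h0, zero_mul, zero_mul, add_zero, add_zero] at e3
      exact htop e3
  have h0 : z 0 ≠ w 0 := by
    intro h0
    rw [← h0] at e2 e4
    rcases (by decide : ∀ a : ZMod 2, a = 0 ∨ a + 1 = 0) (z 0) with hz | hz
    · rw [hz, mul_zero, mul_zero, add_zero, add_zero] at e2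
      have hupper := chiEqn_agree_down h hk (a := k + 1) (b := 2 * k - 3) (by omega)
        (fun i _ _ _ => by omega) e2
      rw [hupper (k + 1) le_rfl (by omega) (by omega)] at e4
      exact hs (add_right_cancel e4)
    · rw [hz, zero_mul, zero_mul, add_zero, add_zero] at e4
      exact hs e4
  have hstep : ∀ i, i + 4 ≤ 2 * k → i % 2 = 0 → z i ≠ w i →
      z (i + 2) ≠ w (i + 2) ∧ chiEqn k z (i + 1) = 0 := by
    intro i hi hpar hne
    rw [eq_chiEqn_add hk (z := z) (i := i) (by omega) (by omega),
      eq_chiEqn_add hk (z := w) (i := i) (by omega) (by omega), ← h _ (by omega), ← h _ (by omega)] at hne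
    exact (by decide : ∀ a b c d : ZMod 2, a + (b + 1) * c ≠ a + (b + 1) * d → c ≠ d ∧ b = 0)
      _ _ _ _ hne
  have heven : ∀ m, 2 * m + 2 ≤ 2 * k → z (2 * m) ≠ w (2 * m) := by
    intro m
    induction m with
    | zero => exact fun _ => h0
    | succ m ih => exact fun hm => (hstep (2 * m) (by omega) (by omega) (ih (by omega))).1
  have hodd : ∀ i, i + 3 ≤ 2 * k → i % 2 = 1 → chiEqn k z i = 0 := by
    intro i hi hpar
    obtain ⟨m, rfl⟩ : ∃ m, i = 2 * m + 1 := ⟨i / 2, by omega⟩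
    exact (hstep (2 * m) (by omega) (by omega) (heven m (by omega))).2
  have hz := eq_zero_of_chiEqn_odd hk hke hodd
  have hw := eq_zero_of_chiEqn_odd (z := w) hk hke fun i hi hpar => by
    rw [← h i (by omega), hodd i hi hpar]
  exact (by decide : ∀ a b c d s t : ZMod 2, s + (a + 1) * b = t + (c + 1) * d → s ≠ t →
    (a = 0 → b = 0) → (c = 0 → d = 0) → False) _ _ _ _ _ _ e4 hs hz hw

end Injective

variable {k : ℕ} {hk : 4 ≤ k}

theorem chiChi_injective (hke : Even k) : Function.Injective (chiChi k hk) := by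
  intro x y hxy
  have := chiEqn_injOn (z := x ∘ chiVar k hk) (w := y ∘ chiVar k hk) (fun p hp => by
    have h := congrFun hxy (chiOut k hk p)
    rw [chiChi_chiOut x hp, chiChi_chiOut y hp] at h
    exact add_right_cancel h) hk hke
  funext i
  simpa [chiVar_chiPos] using this (chiPos k i) (chiPos_lt hk i)

theorem exists_chiChi_polynomial (i : Fin (2 * k)) :
    ∃ P : MvPolynomial (Fin (2 * k)) (ZMod 2), P.totalDegree ≤ 2 ∧
      ∀ x, MvPolynomial.eval x P = chiChi k hk x i := by
  obtain ⟨p, hp, rfl⟩ := chiOut_surjective (hk := hk) i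
  refine ⟨MvPolynomial.X (chiVar k hk p) + (MvPolynomial.X (chiVar k hk (chiFst k p)) + 1) *
    (MvPolynomial.X (chiVar k hk (chiSnd k p)) + MvPolynomial.C (chiCompl k p)) +
      MvPolynomial.C (chiCompl k p), ?_, fun x => ?_⟩
  · have hlin : ∀ (j : Fin (2 * k)) (a : ZMod 2), (MvPolynomial.X j + MvPolynomial.C a :
        MvPolynomial (Fin (2 * k)) (ZMod 2)).totalDegree ≤ 1 := fun j a =>
      (MvPolynomial.totalDegree_add _ _).trans (max_le (by simp) (by simp))
    refine (MvPolynomial.totalDegree_add _ _).trans (max_le ?_ (by simp))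
    refine (MvPolynomial.totalDegree_add _ _).trans (max_le (by simp) ?_)
    refine (MvPolynomial.totalDegree_mul _ _).trans (add_le_add ?_ (hlin _ _))
    simpa using hlin (chiVar k hk (chiFst k p)) 1
  · rw [chiChi_chiOut x hp]
    simp [chiEqn]

section Lower

variable {k : ℕ} {hk : 4 ≤ k} {e : Equiv.Perm (Fin (2 * k) → ZMod 2)}
  {c : Fin (2 * k) → ZMod 2} {T : ℕ → Prop} {pt : ℕ → ZMod 2} {f : ℕ → ℕ}

theorem chiEqn_congr (hk : 4 ≤ k) {z w : ℕ → ZMod 2} (h : ∀ p < 2 * k, z p = w p) {p : ℕ}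
    (hp : p < 2 * k) : chiEqn k z p = chiEqn k w p := by
  rw [chiEqn, chiEqn, h p hp, h _ (chiFst_lt hk hp), h _ (chiSnd_lt hk hp)]

theorem chiFst_inj {p q : ℕ} (h : chiFst k p = chiFst k q) : p = q := by
  unfold chiFst at h; split_ifs at h <;> omega

theorem chiFst_ne_chiSnd (hk : 4 ≤ k) (p : ℕ) : chiFst k p ≠ chiSnd k p := by
  unfold chiFst chiSnd; split_ifs <;> omega

/-- The vector whose entry at position `m` is `pt m`. -/
def chiPoint (k : ℕ) (pt : ℕ → ZMod 2) (i : Fin (2 * k)) : ZMod 2 := pt (chiPos k i)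

theorem chiPoint_chiVar {m : ℕ} (hm : m < 2 * k) : chiPoint k pt (chiVar k hk m) = pt m := by
  rw [chiPoint, chiPos_chiVar hm]

theorem eq_chiPoint {x : Fin (2 * k) → ZMod 2} (h : ∀ p < 2 * k, (x ∘ chiVar k hk) p = pt p) :
    x = chiPoint k pt := by
  funext i
  rw [chiPoint, ← h _ (chiPos_lt hk i), Function.comp_apply, chiVar_chiPos]

theorem exists_chiFibre (he : ∀ x, e x = chiChi k hk x)
    (hc : algebraicDegree (componentFunction e.symm c) < k) (pt : ℕ → ZMod 2)
    (hf : ∀ p < 2 * k, T p → f p < k)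
    (hinj : ∀ p < 2 * k, T p → ∀ q < 2 * k, T q → f p = f q → p = q) :
    ∃ V : Finset (Fin (2 * k) → ZMod 2), (∀ x, x ∈ V ↔
      ∀ p < 2 * k, T p → chiEqn k (x ∘ chiVar k hk) p = chiEqn k pt p) ∧ 4 ∣ #V ∧
      ∑ x ∈ V, c ⬝ᵥ x = 0 := by
  classical
  set S := ((range (2 * k)).filter T).image (chiOut k hk) with hS
  have hcard : #S ≤ k := by
    refine card_image_le.trans ?_
    refine (card_le_card_of_injOn (t := range k) f ?_ ?_).trans_eq (card_range k)
    · intro p hp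
      simp only [coe_filter, mem_range, Set.mem_ofPred_eq] at hp
      simpa using hf p hp.1 hp.2
    · intro p hp q hq h
      simp only [coe_filter, mem_range, Set.mem_ofPred_eq] at hp hq
      exact hinj p hp.1 hp.2 q hq.1 hq.2 h
  refine ⟨univ.filter fun x => ∀ i ∈ S, e x i = e (chiPoint k pt) i, fun x => ?_,
    four_dvd_card_fibre e S _ (by omega) hcard, sum_fibre_eq_zero e S _ hc hcard⟩
  rw [mem_filter]
  simp only [mem_univ, true_and, hS, mem_image, mem_filter, mem_range, he,
    forall_exists_index, and_imp]
  constructor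
  · intro h p hp hTp
    have := h _ p hp hTp rfl
    rw [chiChi_chiOut x hp, chiChi_chiOut _ hp] at this
    rw [add_right_cancel this]
    exact chiEqn_congr hk (fun q hq => chiPoint_chiVar hq) hp
  · rintro h _ p hp hTp rfl
    rw [chiChi_chiOut x hp, chiChi_chiOut _ hp, h p hp hTp]
    congr 1
    exact chiEqn_congr hk (fun q hq => (chiPoint_chiVar hq).symm) hp

theorem dotProduct_chiPoint_eq (he : ∀ x, e x = chiChi k hk x)
    (hc : algebraicDegree (componentFunction e.symm c) < k)
    (hf : ∀ p < 2 * k, T p → f p < k)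
    (hinj : ∀ p < 2 * k, T p → ∀ q < 2 * k, T q → f p = f q → p = q) {K : ZMod 2}
    (hK : ∀ x, (∀ p < 2 * k, T p → chiEqn k (x ∘ chiVar k hk) p = chiEqn k pt p) →
      x ≠ chiPoint k pt → c ⬝ᵥ x = K) : c ⬝ᵥ chiPoint k pt = K := by
  obtain ⟨V, hV, h4, hsum⟩ := exists_chiFibre he hc pt hf hinj
  have hpt : chiPoint k pt ∈ V :=
    (hV _).2 fun p hp _ => chiEqn_congr hk (fun q hq => chiPoint_chiVar hq) hp
  rw [sum_eq_of_eq_off_point (by omega) hpt fun x hx => hK x ((hV x).1 hx)] at hsum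
  exact sub_eq_zero.1 hsum

theorem component_eq_zero_of_flip (he : ∀ x, e x = chiChi k hk x)
    (hc : algebraicDegree (componentFunction e.symm c) < k)
    (hf : ∀ p < 2 * k, T p → f p < k)
    (hinj : ∀ p < 2 * k, T p → ∀ q < 2 * k, T q → f p = f q → p = q)
    {u l : ℕ} (hu : u + 2 < 2 * k ∨ u = 2 * k - 1) (hl : l < 2 * k) (hTu : T u) (hTl : T l)
    (hlu : l ≠ u) (hTv : ¬ T (chiFst k u)) (hv : ∀ p < 2 * k, T p → chiSnd k p ≠ chiFst k u)
    (hTp : ∀ p < 2 * k, T p → p ≠ l → chiFst k p ≠ u ∧ chiSnd k p ≠ u)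
    (hsec : chiFst k l = u ∨ chiSnd k l = u → ∀ p < 2 * k, T p → chiFst k p ≠ l ∧ chiSnd k p ≠ l)
    (hcl : c (chiVar k hk l) = 0 ∨ ((chiFst k l = u → pt (chiSnd k l) + chiCompl k l = 0) ∧
      (chiSnd k l = u → pt (chiFst k l) = 1)))
    (hptv : pt (chiFst k u) = 0) (hptu : pt (chiSnd k u) = 1)
    (huniq : ∀ z : ℕ → ZMod 2, (∀ p < 2 * k, T p → chiEqn k z p = chiEqn k pt p) →
      z (chiFst k u) = 0 → z (chiSnd k u) = 1 → ∀ p < 2 * k, z p = pt p) :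
    c (chiVar k hk u) = 0 := by
  classical
  obtain ⟨V, hV, h4, hsum⟩ := exists_chiFibre he hc pt hf hinj
  have hpt : chiPoint k pt ∈ V :=
    (hV _).2 fun p hp _ => chiEqn_congr hk (fun q hq => chiPoint_chiVar hq) hp
  have hu2 : u < 2 * k := by omega
  have hv2 := chiFst_lt hk hu2
  have hr2 := chiSnd_lt hk hu2
  have hcu : chiCompl k u = 0 := if_neg (by omega)
  have huv : u ≠ chiFst k u := fun h => hTv (h ▸ hTu)
  have hlv : l ≠ chiFst k u := fun h => hTv (h ▸ hTl)
  have hru : chiSnd k u ≠ u := (hTp u hu2 hTu hlu.symm).2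
  set v := chiFst k u with hvdef
  set r := chiSnd k u with hrdef
  let μ : (ℕ → ZMod 2) → ZMod 2 := fun z =>
    if chiFst k l = u then z r * (z (chiSnd k l) + chiCompl k l)
    else if chiSnd k l = u then z r * (z (chiFst k l) + 1) else 0
  have hμ0 : ∀ z, z r = 0 → μ z = 0 := fun z hz => by simp [μ, hz]
  have hμl : ∀ z, ¬ (chiFst k l = u ∨ chiSnd k l = u) → μ z = 0 := fun z hz => by
    rw [not_or] at hz; simp [μ, hz]
  let D : (Fin (2 * k) → ZMod 2) → Fin (2 * k) → ZMod 2 := fun x =>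
    Pi.single (chiVar k hk v) 1 + Pi.single (chiVar k hk u) ((x ∘ chiVar k hk) r) +
      Pi.single (chiVar k hk l) (μ (x ∘ chiVar k hk))
  have hsingle : ∀ (m n : ℕ) (a : ZMod 2), m < 2 * k → n < 2 * k →
      (Pi.single (chiVar k hk m) a : Fin (2 * k) → ZMod 2) (chiVar k hk n) =
        if n = m then a else 0 := by
    intro m n a hm hn
    rw [Pi.single_apply]
    refine if_congr ⟨fun h => chiVar_inj hn hm h, fun h => by rw [h]⟩ rfl rfl
  have hDval : ∀ x n, n < 2 * k → D x (chiVar k hk n) = (if n = v then 1 else 0) +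
      (if n = u then (x ∘ chiVar k hk) r else 0) +
      (if n = l then μ (x ∘ chiVar k hk) else 0) := by
    intro x n hn
    simp only [D, Pi.add_apply]
    rw [hsingle v n _ hv2 hn, hsingle u n _ hu2 hn, hsingle l n _ hl hn]
  have hval : ∀ x n, n < 2 * k → ((x + D x) ∘ chiVar k hk) n = (x ∘ chiVar k hk) n +
      ((if n = v then 1 else 0) + (if n = u then (x ∘ chiVar k hk) r else 0) +
      (if n = l then μ (x ∘ chiVar k hk) else 0)) := fun x n hn => by
    rw [← hDval x n hn]; rfl
  have hsame : ∀ x n, n < 2 * k → n ≠ v → n ≠ u →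
      ((chiFst k l = u ∨ chiSnd k l = u) → n ≠ l) →
      ((x + D x) ∘ chiVar k hk) n = (x ∘ chiVar k hk) n := by
    intro x n hn h1 h2 h3
    rw [hval x n hn, if_neg h1, if_neg h2]
    by_cases hs : chiFst k l = u ∨ chiSnd k l = u
    · rw [if_neg (h3 hs)]; simp
    · rw [hμl _ hs]; simp
  have hvalu : ∀ x, ((x + D x) ∘ chiVar k hk) u =
      (x ∘ chiVar k hk) u + (x ∘ chiVar k hk) r := fun x => by
    rw [hval x u hu2, if_neg huv, if_pos rfl, if_neg hlu.symm]; simp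
  have hvalr : ∀ x, ((x + D x) ∘ chiVar k hk) r = (x ∘ chiVar k hk) r := fun x =>
    hsame x r hr2 (hv u hu2 hTu) hru fun h => (hsec h u hu2 hTu).2
  have hvall : ∀ x, ((x + D x) ∘ chiVar k hk) l =
      (x ∘ chiVar k hk) l + μ (x ∘ chiVar k hk) := fun x => by
    rw [hval x l hl, if_neg hlv, if_neg hlu, if_pos rfl]; simp
  have hfl : chiFst k l ≠ v := fun h => hlu (chiFst_inj h)
  have hsl : chiSnd k l ≠ v := hv l hl hTl
  have hfsl := chiFst_ne_chiSnd hk l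
  have hvalfl : ∀ x, chiSnd k l = u → ((x + D x) ∘ chiVar k hk) (chiFst k l) =
      (x ∘ chiVar k hk) (chiFst k l) := fun x h =>
    hsame x _ (chiFst_lt hk hl) hfl (fun h' => hfsl (h'.trans h.symm))
      fun h' => (hsec h' l hl hTl).1
  have hvalsl : ∀ x, chiFst k l = u → ((x + D x) ∘ chiVar k hk) (chiSnd k l) =
      (x ∘ chiVar k hk) (chiSnd k l) := fun x h =>
    hsame x _ (chiSnd_lt hk hl) hsl (fun h' => hfsl (h.trans h'.symm))
      fun h' => (hsec h' l hl hTl).2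
  have hμ : ∀ x, μ ((x + D x) ∘ chiVar k hk) = μ (x ∘ chiVar k hk) := by
    intro x
    by_cases h1 : chiFst k l = u
    · simp only [μ, if_pos h1, hvalr, hvalsl x h1]
    by_cases h2 : chiSnd k l = u
    · simp only [μ, if_neg h1, if_pos h2, hvalr, hvalfl x h2]
    · simp only [μ, if_neg h1, if_neg h2]
  have hEqn : ∀ x p, p < 2 * k → T p →
      chiEqn k ((x + D x) ∘ chiVar k hk) p = chiEqn k (x ∘ chiVar k hk) p := by
    intro x p hp hT
    by_cases hpu : p = u
    · subst hpu
      rw [chiEqn, chiEqn, hvalu, ← hrdef, hvalr, ← hvdef, hval x v hv2, if_pos rfl,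
        if_neg huv.symm, if_neg hlv.symm, hcu]
      exact (by decide : ∀ a b c : ZMod 2, a + c + (b + (1 + 0 + 0) + 1) * (c + 0) =
        a + (b + 1) * (c + 0)) _ _ _
    by_cases hpl : p = l
    · subst hpl
      rw [chiEqn, chiEqn, hvall]
      by_cases h1 : chiFst k p = u
      · rw [hvalsl x h1, h1, hvalu]
        simp only [μ, if_pos h1]
        generalize (x ∘ chiVar k hk) (chiSnd k p) + chiCompl k p = s
        exact (by decide : ∀ a b c s : ZMod 2, a + c * s + (b + c + 1) * s =
          a + (b + 1) * s) _ _ _ _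
      by_cases h2 : chiSnd k p = u
      · rw [hvalfl x h2, h2, hvalu]
        simp only [μ, if_neg h1, if_pos h2]
        exact (by decide : ∀ a b c s d : ZMod 2, a + c * (s + 1) + (s + 1) * (b + c + d) =
          a + (s + 1) * (b + d)) _ _ _ _ _
      · rw [hsame x _ (chiFst_lt hk hp) hfl h1 fun h => absurd h (not_or.2 ⟨h1, h2⟩),
          hsame x _ (chiSnd_lt hk hp) hsl h2 fun h => absurd h (not_or.2 ⟨h1, h2⟩),
          hμl _ (not_or.2 ⟨h1, h2⟩), add_zero]
    · rw [chiEqn, chiEqn, hsame x p hp (fun h => hTv (h ▸ hT)) hpu fun _ => hpl,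
        hsame x _ (chiFst_lt hk hp) (fun h => hpu (chiFst_inj h)) (hTp p hp hT hpl).1
          fun h => (hsec h p hp hT).1,
        hsame x _ (chiSnd_lt hk hp) (hv p hp hT) (hTp p hp hT hpl).2
          fun h => (hsec h p hp hT).2]
  have hdot : ∀ x, c ⬝ᵥ D x = c (chiVar k hk v) + c (chiVar k hk u) * (x ∘ chiVar k hk) r +
      c (chiVar k hk l) * μ (x ∘ chiVar k hk) := by
    intro x
    simp only [D, dotProduct_add, dotProduct_single, mul_one]
  have hfinal := dotProduct_flip_eq h4 hsum D (chiVar k hk v) hpt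
    (by rw [chiPoint_chiVar hv2, hptv])
    (fun x hx => (hV _).2 fun p hp hT => by rw [hEqn x p hp hT, (hV x).1 hx p hp hT])
    (fun x _ => by simp only [D, hvalr, hμ])
    (fun x _ => by rw [hDval x v hv2, if_pos rfl, if_neg huv.symm, if_neg hlv.symm]; simp)
    (fun x hx hxv hne => by
      have h0 : (x ∘ chiVar k hk) r = 0 := by
        by_contra h
        have h1 := (by decide : ∀ a : ZMod 2, ¬ a = 0 → a = 1) _ h
        exact hne (eq_chiPoint (huniq _ ((hV x).1 hx) hxv h1))
      rw [hdot, h0, hμ0 _ h0, mul_zero, mul_zero, add_zero, add_zero])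
  have hptc : ∀ m < 2 * k, (chiPoint k pt ∘ chiVar k hk) m = pt m := fun m hm =>
    chiPoint_chiVar hm
  rw [hdot, hptc r hr2, hptu, mul_one] at hfinal
  have hlast : c (chiVar k hk l) * μ (chiPoint k pt ∘ chiVar k hk) = 0 := by
    rcases hcl with h | ⟨h1, h2⟩
    · rw [h, zero_mul]
    by_cases hl1 : chiFst k l = u
    · simp only [μ, if_pos hl1, hptc _ (chiSnd_lt hk hl), h1 hl1, mul_zero]
    by_cases hl2 : chiSnd k l = u
    · simp only [μ, if_neg hl1, if_pos hl2, hptc _ (chiFst_lt hk hl), h2 hl2]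
      simp [CharTwo.add_self_eq_zero]
    · simp only [μ, if_neg hl1, if_neg hl2, mul_zero]
  rw [hlast, add_zero] at hfinal
  exact left_eq_add.1 hfinal.symm

end Lower

section Families

variable {k : ℕ} {hk : 4 ≤ k} {e : Equiv.Perm (Fin (2 * k) → ZMod 2)}
  {c : Fin (2 * k) → ZMod 2} {T : ℕ → Prop} {pt z : ℕ → ZMod 2}

theorem chiEqn_solve_target {p : ℕ} (hz : chiEqn k z p = chiEqn k pt p)
    (h1 : z (chiFst k p) = pt (chiFst k p)) (h2 : z (chiSnd k p) = pt (chiSnd k p)) :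
    z p = pt p := by
  rw [chiEqn, chiEqn, h1, h2] at hz
  exact add_right_cancel hz

theorem chiEqn_solve_factors {p : ℕ} (hz : chiEqn k z p = chiEqn k pt p) (hp : z p = pt p)
    (h1 : pt (chiFst k p) = 0) (h2 : pt (chiSnd k p) = 1 + chiCompl k p) :
    z (chiFst k p) = pt (chiFst k p) ∧ z (chiSnd k p) = pt (chiSnd k p) := by
  rw [chiEqn, chiEqn, hp, h1, h2] at hz
  rw [h1, h2]
  exact (by decide : ∀ a b d : ZMod 2, (a + 1) * (b + d) = (0 + 1) * (1 + d + d) →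
    a = 0 ∧ b = 1 + d) _ _ _ (add_left_cancel hz)

theorem chiEqn_chain (hz : ∀ p < 2 * k, T p → chiEqn k z p = chiEqn k pt p) {a b : ℕ}
    (hab : a % 2 = b % 2) (hb : b + 2 ≤ 2 * k)
    (hT : ∀ p, a ≤ p → p + 2 ≤ b → p % 2 = a % 2 →
      T p ∧ p ≠ k - 1 ∧ pt (p + 1) = 0 ∧ pt (p + 2) = 1)
    (ha : z a = pt a) : ∀ n, a ≤ n → n ≤ b → z n = pt n := by
  have key : ∀ m, a + 2 * m ≤ b →
      z (a + 2 * m) = pt (a + 2 * m) ∧ (m ≠ 0 → z (a + 2 * m - 1) = pt (a + 2 * m - 1)) := by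
    intro m
    induction m with
    | zero => exact fun _ => ⟨ha, fun h => absurd rfl h⟩
    | succ m ih =>
      intro hm
      obtain ⟨h1, h2, h3, h4⟩ := hT (a + 2 * m) (by omega) (by omega) (by omega)
      have := chiEqn_solve_factors (hz _ (by omega) h1) (ih (by omega)).1
        (by rw [chiFst_eq (by omega), h3])
        (by rw [chiSnd_eq (by omega) h2, h4, chiCompl, if_neg (by omega), add_zero])
      rw [chiFst_eq (by omega), chiSnd_eq (by omega) h2] at this
      exact ⟨this.2, fun _ => this.1⟩
  intro n h1 h2
  rcases Nat.mod_two_eq_zero_or_one (n - a) with h | h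
  · have := (key ((n - a) / 2) (by omega)).1
    rwa [show a + 2 * ((n - a) / 2) = n by omega] at this
  · have := (key ((n - a) / 2 + 1) (by omega)).2 (by omega)
    rwa [show a + 2 * ((n - a) / 2 + 1) - 1 = n by omega] at this

theorem component_zero (he : ∀ x, e x = chiChi k hk x) (hk2 : k % 2 = 0)
    (hc : algebraicDegree (componentFunction e.symm c) < k) : c (chiVar k hk 0) = 0 := by
  refine component_eq_zero_of_flip he hc (u := 0) (l := 2 * k - 1) (f := fun i => i / 2)
    (T := fun p => p = 2 * k - 1 ∨ (p % 2 = 0 ∧ p + 4 ≤ 2 * k))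
    (pt := fun i => if i % 2 = 0 then 1 else 0)
    (fun p hp _ => by omega) (fun p hp hTp q hq hTq h => by omega)
    (by omega) (by omega) (by omega) (by omega) (by omega)
    ?_ ?_ ?_ ?_ (Or.inr ⟨?_, ?_⟩) ?_ ?_ ?_
  · rw [chiFst_eq (by omega)]; omega
  · intro p hp hT; simp only [chiSnd, chiFst]; split_ifs <;> omega
  · intro p hp hT hpl; simp only [chiSnd, chiFst]; split_ifs <;> omega
  · intro _ p hp hT; simp only [chiSnd, chiFst]; split_ifs <;> omega
  · intro _
    rw [chiSnd_last hk, if_neg (by omega), chiCompl, if_neg (by omega), add_zero]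
  · rw [chiSnd_last hk]; omega
  · rw [chiFst_eq (by omega), if_neg (by omega)]
  · rw [chiSnd_eq (by omega) (by omega), if_pos (by omega)]
  · intro z hz hv hr
    rw [chiFst_eq (by omega)] at hv
    rw [chiSnd_eq (by omega) (by omega)] at hr
    have h2 := chiEqn_chain hz (a := 2) (b := 2 * k - 2) (by omega) (by omega)
      (fun p h1 h2 h3 => ⟨by omega, by omega, if_neg (by omega), if_pos (by omega)⟩)
      (by rw [hr, if_pos (by omega)])
    have h1 : z 1 = if 1 % 2 = 0 then 1 else 0 := by rw [hv, if_neg (by omega)]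
    have h0 := chiEqn_solve_target (hz 0 (by omega) (by omega))
      (by rw [chiFst_eq (by omega)]; exact h1)
      (by rw [chiSnd_eq (by omega) (by omega)]; exact h2 2 (by omega) (by omega))
    have hs := chiEqn_solve_target (hz (2 * k - 1) (by omega) (by omega))
      (by rw [chiFst_last]; exact h0)
      (by rw [chiSnd_last hk]; exact h2 _ (by omega) (by omega))
    intro p hp
    rcases (by omega : p = 0 ∨ p = 1 ∨ (2 ≤ p ∧ p ≤ 2 * k - 2) ∨ p = 2 * k - 1) with
      rfl | rfl | ⟨h, h'⟩ | rfl
    · exact h0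
    · exact h1
    · exact h2 p h h'
    · exact hs

theorem component_upper_odd (he : ∀ x, e x = chiChi k hk x) (hk2 : k % 2 = 0)
    (hc : algebraicDegree (componentFunction e.symm c) < k) {j : ℕ} (hj : j % 2 = 1)
    (hkj : k < j) (hjk : j + 3 ≤ 2 * k) : c (chiVar k hk j) = 0 := by
  have hsnd : chiSnd k j = if j + 3 = 2 * k then 0 else j + 2 := by
    simp only [chiSnd]; split_ifs <;> omega
  refine component_eq_zero_of_flip he hc (u := j) (l := 2 * k - 1) (f := fun i => i / 2)
    (T := fun p => (p % 2 = 1 ∧ j ≤ p) ∨ (p % 2 = 0 ∧ p + 3 ≤ j))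
    (pt := fun i => if (i % 2 = 1 ∧ j < i) ∨ (i % 2 = 0 ∧ i < j) then 1 else 0)
    (fun p hp _ => by omega) (fun p hp hTp q hq hTq h => by omega)
    (by omega) (by omega) (by omega) (by omega) (by omega)
    ?_ ?_ ?_ ?_ (Or.inr ⟨?_, ?_⟩) ?_ ?_ ?_
  · rw [chiFst_eq (by omega)]; omega
  · intro p hp hT; simp only [chiSnd, chiFst]; split_ifs <;> omega
  · intro p hp hT hpl; simp only [chiSnd, chiFst]; split_ifs <;> omega
  · intro _ p hp hT; simp only [chiSnd, chiFst]; split_ifs <;> omega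
  · rw [chiFst_last]; omega
  · intro _
    rw [chiFst_last, if_pos (by omega)]
  · rw [chiFst_eq (by omega), if_neg (by omega)]
  · rw [hsnd]
    split_ifs <;> first | rfl | omega
  · intro z hz hv hr
    rw [chiFst_eq (by omega)] at hv
    have hup : (∀ n, j + 2 ≤ n → n ≤ 2 * k - 2 → z n = if (n % 2 = 1 ∧ j < n) ∨
        (n % 2 = 0 ∧ n < j) then 1 else 0) ∧ z 0 = 1 := by
      rcases (by omega : j + 3 = 2 * k ∨ j + 5 ≤ 2 * k) with h | h
      · rw [hsnd, if_pos h] at hr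
        exact ⟨fun n h1 h2 => by omega, hr⟩
      · rw [hsnd, if_neg (by omega)] at hr
        have h2 := chiEqn_chain hz (a := j + 2) (b := 2 * k - 3) (by omega) (by omega)
          (fun p h1 h2 h3 => ⟨by omega, by omega, if_neg (by omega), if_pos (by omega)⟩)
          (by rw [hr, if_pos (by omega)])
        have h3 := chiEqn_solve_factors (hz (2 * k - 3) (by omega) (by omega))
          (h2 _ (by omega) (by omega))
          (by rw [chiFst_eq (by omega), if_neg (by omega)])
          (by rw [chiSnd_sub_three hk, if_pos (by omega), chiCompl, if_neg (by omega), add_zero])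
        rw [chiFst_eq (by omega), chiSnd_sub_three hk, if_pos (c := (0 % 2 = 1 ∧ j < 0) ∨ _)
          (by omega), show 2 * k - 3 + 1 = 2 * k - 2 by omega] at h3
        refine ⟨fun n h4 h5 => ?_, h3.2⟩
        rcases (by omega : n ≤ 2 * k - 3 ∨ n = 2 * k - 2) with h6 | rfl
        · exact h2 n h4 h6
        · exact h3.1
    have hlow := chiEqn_chain hz (a := 0) (b := j - 1) (by omega) (by omega)
      (fun p h1 h2 h3 => ⟨by omega, by omega, if_neg (by omega), if_pos (by omega)⟩)
      (by rw [hup.2, if_pos (by omega)])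
    have hj1 : z (j + 1) = if ((j + 1) % 2 = 1 ∧ j < j + 1) ∨ ((j + 1) % 2 = 0 ∧ j + 1 < j)
      then 1 else 0 := by rw [hv, if_neg (by omega)]
    have hj0 := chiEqn_solve_target (hz j (by omega) (by omega))
      (by rw [chiFst_eq (by omega)]; exact hj1)
      (by rw [hr, hsnd]; split_ifs <;> first | rfl | omega)
    have hall : ∀ p ≤ 2 * k - 2, z p =
        if (p % 2 = 1 ∧ j < p) ∨ (p % 2 = 0 ∧ p < j) then 1 else 0 := by
      intro p hp
      rcases (by omega : p ≤ j - 1 ∨ p = j ∨ p = j + 1 ∨ j + 2 ≤ p) with h | rfl | rfl | h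
      · exact hlow p (by omega) h
      · exact hj0
      · exact hj1
      · exact hup.1 p h hp
    have hs := chiEqn_solve_target (hz (2 * k - 1) (by omega) (by omega))
      (by rw [chiFst_last]; exact hall 0 (by omega))
      (by rw [chiSnd_last hk]; exact hall _ (by omega))
    intro p hp
    rcases (by omega : p ≤ 2 * k - 2 ∨ p = 2 * k - 1) with h | rfl
    · exact hall p h
    · exact hs

theorem component_lower_even (he : ∀ x, e x = chiChi k hk x) (hk2 : k % 2 = 0)
    (hc : algebraicDegree (componentFunction e.symm c) < k) {j : ℕ} (hj : j % 2 = 0)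
    (hj0 : 0 < j) (hjk : j ≤ k) : c (chiVar k hk j) = 0 := by
  refine component_eq_zero_of_flip he hc (u := j) (l := 0) (f := fun i => (i + 1) / 2)
    (T := fun p => p = 0 ∨ (p % 2 = 0 ∧ j ≤ p) ∨ (p % 2 = 1 ∧ p + 3 ≤ j))
    (pt := fun i => if (i % 2 = 0 ∧ j < i) ∨ (i % 2 = 1 ∧ i < j ∧ 1 < i) then 1 else 0)
    (fun p hp _ => by omega) (fun p hp hTp q hq hTq h => by omega)
    (by omega) (by omega) (by omega) (by omega) (by omega)
    ?_ ?_ ?_ ?_ (Or.inl (component_zero he hk2 hc)) ?_ ?_ ?_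
  · rw [chiFst_eq (by omega)]; omega
  · intro p hp hT; simp only [chiSnd, chiFst]; split_ifs <;> omega
  · intro p hp hT hpl; simp only [chiSnd, chiFst]; split_ifs <;> omega
  · intro _ p hp hT; simp only [chiSnd, chiFst]; split_ifs <;> omega
  · rw [chiFst_eq (by omega), if_neg (by omega)]
  · rw [chiSnd_eq (by omega) (by omega), if_pos (by omega)]
  · intro z hz hv hr
    rw [chiFst_eq (by omega)] at hv
    rw [chiSnd_eq (by omega) (by omega)] at hr
    have hup := chiEqn_chain hz (a := j + 2) (b := 2 * k - 2) (by omega) (by omega)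
      (fun p h1 h2 h3 => ⟨by omega, by omega, if_neg (by omega), if_pos (by omega)⟩)
      (by rw [hr, if_pos (by omega)])
    have htop := chiEqn_solve_factors (hz (2 * k - 2) (by omega) (by omega))
      (hup _ (by omega) (by omega))
      (by rw [chiFst_eq (by omega), if_neg (by omega)])
      (by rw [chiSnd_sub_two hk, if_neg (by omega), chiCompl, if_pos rfl]; rfl)
    rw [chiFst_eq (by omega), chiSnd_sub_two hk, show 2 * k - 2 + 1 = 2 * k - 1 by omega] at htop
    have hlow := chiEqn_chain hz (a := 1) (b := j - 1) (by omega) (by omega)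
      (fun p h1 h2 h3 => ⟨by omega, by omega, if_neg (by omega), if_pos (by omega)⟩) htop.2
    have hj1 : z (j + 1) = if ((j + 1) % 2 = 0 ∧ j < j + 1) ∨
        ((j + 1) % 2 = 1 ∧ j + 1 < j ∧ 1 < j + 1) then 1 else 0 := by rw [hv, if_neg (by omega)]
    have hj0 := chiEqn_solve_target (hz j (by omega) (by omega))
      (by rw [chiFst_eq (by omega)]; exact hj1)
      (by rw [chiSnd_eq (by omega) (by omega)]; exact hup _ (by omega) (by omega))
    have hpos : ∀ p, 0 < p → p < 2 * k → z p =
        if (p % 2 = 0 ∧ j < p) ∨ (p % 2 = 1 ∧ p < j ∧ 1 < p) then 1 else 0 := by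
      intro p hp hp'
      rcases (by omega : p ≤ j - 1 ∨ p = j ∨ p = j + 1 ∨ (j + 2 ≤ p ∧ p ≤ 2 * k - 2) ∨
        p = 2 * k - 1) with h | rfl | rfl | ⟨h, h'⟩ | rfl
      · exact hlow p (by omega) h
      · exact hj0
      · exact hj1
      · exact hup p h h'
      · exact htop.1
    have h0 := chiEqn_solve_target (hz 0 (by omega) (by omega))
      (by rw [chiFst_eq (by omega)]; exact hpos _ (by omega) (by omega))
      (by rw [chiSnd_eq (by omega) (by omega)]; exact hpos _ (by omega) (by omega))
    intro p hp
    rcases Nat.eq_zero_or_pos p with rfl | h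
    · exact h0
    · exact hpos p h hp

theorem component_lower_odd (he : ∀ x, e x = chiChi k hk x) (hk2 : k % 2 = 0)
    (hc : algebraicDegree (componentFunction e.symm c) < k) {j : ℕ} (hj : j % 2 = 1)
    (hjk : j < k) : c (chiVar k hk j) = 0 := by
  have hsnd : chiSnd k j = if j = k - 1 then 2 * k - 1 else j + 2 := by
    simp only [chiSnd]; split_ifs <;> omega
  refine component_eq_zero_of_flip he hc (u := j) (l := 2 * k - 2)
    (f := fun i => if i = 2 * k - 1 then j / 2 else (i + 1) / 2)
    (T := fun p => (p % 2 = 1 ∧ j ≤ p ∧ p ≠ 2 * k - 3) ∨ p = 2 * k - 2 ∨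
      (p % 2 = 0 ∧ p + 3 ≤ j))
    (pt := fun i => if (i % 2 = 1 ∧ j < i) ∨ (i % 2 = 0 ∧ i < j ∧ i ≠ 0) then 1 else 0)
    (fun p hp _ => by split_ifs <;> omega)
    (fun p hp hTp q hq hTq h => by split_ifs at h <;> omega)
    (by omega) (by omega) (by omega) (by omega) (by omega)
    ?_ ?_ ?_ ?_ (Or.inr ⟨?_, ?_⟩) ?_ ?_ ?_
  · rw [chiFst_eq (by omega)]; omega
  · intro p hp hT; simp only [chiSnd, chiFst]; split_ifs <;> omega
  · intro p hp hT hpl; simp only [chiSnd, chiFst]; split_ifs <;> omega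
  · intro _ p hp hT; simp only [chiSnd, chiFst]; split_ifs <;> omega
  · rw [chiFst_eq (by omega)]; omega
  · intro _
    rw [chiFst_eq (by omega), if_pos (by omega)]
  · rw [chiFst_eq (by omega), if_neg (by omega)]
  · rw [hsnd]
    split_ifs <;> first | rfl | omega
  · intro z hz hv hr
    rw [chiFst_eq (by omega)] at hv
    have hj1 : z (j + 1) = if ((j + 1) % 2 = 1 ∧ j < j + 1) ∨
        ((j + 1) % 2 = 0 ∧ j + 1 < j ∧ j + 1 ≠ 0) then 1 else 0 := by rw [hv, if_neg (by omega)]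
    have hup : (∀ n, j < n → n ≤ k → z n = if (n % 2 = 1 ∧ j < n) ∨
        (n % 2 = 0 ∧ n < j ∧ n ≠ 0) then 1 else 0) ∧ z (2 * k - 1) = 1 := by
      rcases (by omega : j = k - 1 ∨ j + 3 ≤ k) with h | h
      · rw [hsnd, if_pos h] at hr
        refine ⟨fun n h1 h2 => ?_, hr⟩
        obtain rfl : n = j + 1 := by omega
        exact hj1
      · rw [hsnd, if_neg (by omega)] at hr
        have h2 := chiEqn_chain hz (a := j + 2) (b := k - 1) (by omega) (by omega)
          (fun p h1 h2 h3 => ⟨by omega, by omega, if_neg (by omega), if_pos (by omega)⟩)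
          (by rw [hr, if_pos (by omega)])
        have h3 := chiEqn_solve_factors (hz (k - 1) (by omega) (by omega))
          (h2 _ (by omega) (by omega))
          (by rw [chiFst_eq (by omega), if_neg (by omega)])
          (by rw [chiSnd_pred, if_pos (by omega), chiCompl, if_neg (by omega), add_zero])
        rw [chiFst_eq (by omega), chiSnd_pred, Nat.sub_add_cancel (by omega)] at h3
        refine ⟨fun n h4 h5 => ?_, h3.2.trans (if_pos (by omega))⟩
        rcases (by omega : n = j + 1 ∨ (j + 2 ≤ n ∧ n ≤ k - 1) ∨ n = k) with rfl | ⟨h6, h7⟩ | rfl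
        · exact hj1
        · exact h2 n h6 h7
        · exact h3.1
    have hs := chiEqn_solve_factors (hz (2 * k - 1) (by omega) (by omega))
      (by rw [hup.2, if_pos (by omega)])
      (by rw [chiFst_last, if_neg (by omega)])
      (by rw [chiSnd_last hk, if_pos (by omega), chiCompl, if_neg (by omega), add_zero])
    rw [chiFst_last, chiSnd_last hk] at hs
    have hupp := chiEqn_chain hz (a := k + 1) (b := 2 * k - 3) (by omega) (by omega)
      (fun p h1 h2 h3 => ⟨by omega, by omega, if_neg (by omega), if_pos (by omega)⟩) hs.2
    have hlow := chiEqn_chain hz (a := 0) (b := j - 1) (by omega) (by omega)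
      (fun p h1 h2 h3 => ⟨by omega, by omega, if_neg (by omega), if_pos (by omega)⟩) hs.1
    have hj0 := chiEqn_solve_target (hz j (by omega) (by omega))
      (by rw [chiFst_eq (by omega)]; exact hj1)
      (by rw [hr, hsnd]; split_ifs <;> first | rfl | omega)
    have hall : ∀ p ≤ 2 * k - 3, z p =
        if (p % 2 = 1 ∧ j < p) ∨ (p % 2 = 0 ∧ p < j ∧ p ≠ 0) then 1 else 0 := by
      intro p hp
      rcases (by omega : p ≤ j - 1 ∨ p = j ∨ (j < p ∧ p ≤ k) ∨ k + 1 ≤ p) with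
        h | rfl | ⟨h, h'⟩ | h
      · exact hlow p (by omega) h
      · exact hj0
      · exact hup.1 p h h'
      · exact hupp p h hp
    have hlast : z (2 * k - 1) = if ((2 * k - 1) % 2 = 1 ∧ j < 2 * k - 1) ∨
        ((2 * k - 1) % 2 = 0 ∧ 2 * k - 1 < j ∧ 2 * k - 1 ≠ 0) then 1 else 0 := by
      rw [hup.2, if_pos (by omega)]
    have htop := chiEqn_solve_target (hz (2 * k - 2) (by omega) (by omega))
      (by rw [chiFst_eq (by omega), show 2 * k - 2 + 1 = 2 * k - 1 by omega]; exact hlast)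
      (by rw [chiSnd_sub_two hk]; exact hall _ (by omega))
    intro p hp
    rcases (by omega : p ≤ 2 * k - 3 ∨ p = 2 * k - 2 ∨ p = 2 * k - 1) with h | rfl | rfl
    · exact hall p h
    · exact htop
    · exact hlast

theorem component_upper_even (he : ∀ x, e x = chiChi k hk x) (hk2 : k % 2 = 0)
    (hc : algebraicDegree (componentFunction e.symm c) < k) {j : ℕ} (hj : j % 2 = 0)
    (hkj : k < j) (hjk : j + 4 ≤ 2 * k) : c (chiVar k hk j) = 0 := by
  refine component_eq_zero_of_flip he hc (u := j) (l := 0)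
    (f := fun i => if i = 2 * k - 1 then k / 2 else (i + 1) / 2)
    (T := fun p => (p % 2 = 0 ∧ j ≤ p) ∨ p = 2 * k - 1 ∨ (p % 2 = 0 ∧ p + 2 ≤ k) ∨
      (p % 2 = 1 ∧ k < p ∧ p + 3 ≤ j))
    (pt := fun i => if (i % 2 = 0 ∧ (j < i ∨ i ≤ k) ∧ i ≠ 0) ∨ (i % 2 = 1 ∧ i < j ∧ k < i)
      then 1 else 0)
    (fun p hp _ => by split_ifs <;> omega)
    (fun p hp hTp q hq hTq h => by split_ifs at h <;> omega)
    (by omega) (by omega) (by omega) (by omega) (by omega)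
    ?_ ?_ ?_ ?_ (Or.inl (component_zero he hk2 hc)) ?_ ?_ ?_
  · rw [chiFst_eq (by omega)]; omega
  · intro p hp hT; simp only [chiSnd, chiFst]; split_ifs <;> omega
  · intro p hp hT hpl; simp only [chiSnd, chiFst]; split_ifs <;> omega
  · rw [chiFst_eq (by omega), chiSnd_eq (by omega) (by omega)]; omega
  · rw [chiFst_eq (by omega), if_neg (by omega)]
  · rw [chiSnd_eq (by omega) (by omega), if_pos (by omega)]
  · intro z hz hv hr
    rw [chiFst_eq (by omega)] at hv
    rw [chiSnd_eq (by omega) (by omega)] at hr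
    have hup := chiEqn_chain hz (a := j + 2) (b := 2 * k - 2) (by omega) (by omega)
      (fun p h1 h2 h3 => ⟨by omega, by omega, if_neg (by omega), if_pos (by omega)⟩)
      (by rw [hr, if_pos (by omega)])
    have htop := chiEqn_solve_factors (hz (2 * k - 2) (by omega) (by omega))
      (hup _ (by omega) (by omega))
      (by rw [chiFst_eq (by omega), if_neg (by omega)])
      (by rw [chiSnd_sub_two hk, if_neg (by omega), chiCompl, if_pos rfl]; rfl)
    rw [chiFst_eq (by omega), chiSnd_sub_two hk, show 2 * k - 2 + 1 = 2 * k - 1 by omega] at htop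
    have hs := chiEqn_solve_factors (hz (2 * k - 1) (by omega) (by omega)) htop.1
      (by rw [chiFst_last, if_neg (by omega)])
      (by rw [chiSnd_last hk, if_pos (by omega), chiCompl, if_neg (by omega), add_zero])
    rw [chiFst_last, chiSnd_last hk] at hs
    have hlow := chiEqn_chain hz (a := 0) (b := k) (by omega) (by omega)
      (fun p h1 h2 h3 => ⟨by omega, by omega, if_neg (by omega), if_pos (by omega)⟩) hs.1
    have hmid := chiEqn_chain hz (a := k + 1) (b := j - 1) (by omega) (by omega)
      (fun p h1 h2 h3 => ⟨by omega, by omega, if_neg (by omega), if_pos (by omega)⟩) hs.2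
    have hj1 : z (j + 1) = if ((j + 1) % 2 = 0 ∧ (j < j + 1 ∨ j + 1 ≤ k) ∧ j + 1 ≠ 0) ∨
        ((j + 1) % 2 = 1 ∧ j + 1 < j ∧ k < j + 1) then 1 else 0 := by rw [hv, if_neg (by omega)]
    have hj0 := chiEqn_solve_target (hz j (by omega) (by omega))
      (by rw [chiFst_eq (by omega)]; exact hj1)
      (by rw [chiSnd_eq (by omega) (by omega)]; exact hup _ (by omega) (by omega))
    intro p hp
    rcases (by omega : p ≤ k ∨ (k + 1 ≤ p ∧ p ≤ j - 1) ∨ p = j ∨ p = j + 1 ∨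
      (j + 2 ≤ p ∧ p ≤ 2 * k - 2) ∨ p = 2 * k - 1) with h | ⟨h, h'⟩ | rfl | rfl | ⟨h, h'⟩ | rfl
    · exact hlow p (by omega) h
    · exact hmid p h h'
    · exact hj0
    · exact hj1
    · exact hup p h h'
    · exact htop.1

theorem dotProduct_eq_top (he : ∀ x, e x = chiChi k hk x) (hk2 : k % 2 = 0)
    (hc : algebraicDegree (componentFunction e.symm c) < k) (x : Fin (2 * k) → ZMod 2) :
    c ⬝ᵥ x = c (chiVar k hk (2 * k - 2)) * x (chiVar k hk (2 * k - 2)) +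
      c (chiVar k hk (2 * k - 1)) * x (chiVar k hk (2 * k - 1)) := by
  have hne : chiVar k hk (2 * k - 2) ≠ chiVar k hk (2 * k - 1) := fun h => by
    have := chiVar_inj (by omega) (by omega) h
    omega
  refine Fintype.sum_eq_add _ _ hne fun i hi => ?_
  obtain ⟨m, hm, rfl⟩ : ∃ m < 2 * k, chiVar k hk m = i := ⟨_, chiPos_lt hk i, chiVar_chiPos i⟩
  have h1 : m ≠ 2 * k - 2 := fun h => hi.1 (by rw [h])
  have h2 : m ≠ 2 * k - 1 := fun h => hi.2 (by rw [h])
  have h0 : c (chiVar k hk m) = 0 := by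
    rcases (by omega : m = 0 ∨ (m % 2 = 0 ∧ 0 < m ∧ m ≤ k) ∨ (m % 2 = 1 ∧ m < k) ∨
      (m % 2 = 0 ∧ k < m ∧ m + 4 ≤ 2 * k) ∨ (m % 2 = 1 ∧ k < m ∧ m + 3 ≤ 2 * k)) with
      rfl | ⟨h, h', h''⟩ | ⟨h, h'⟩ | ⟨h, h', h''⟩ | ⟨h, h', h''⟩
    · exact component_zero he hk2 hc
    · exact component_lower_even he hk2 hc h h' h''
    · exact component_lower_odd he hk2 hc h h'
    · exact component_upper_even he hk2 hc h h' h''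
    · exact component_upper_odd he hk2 hc h h' h''
  rw [h0, zero_mul]

theorem component_top_add (he : ∀ x, e x = chiChi k hk x) (hk2 : k % 2 = 0)
    (hc : algebraicDegree (componentFunction e.symm c) < k) :
    c (chiVar k hk (2 * k - 2)) + c (chiVar k hk (2 * k - 1)) = 0 := by
  have hpt := dotProduct_chiPoint_eq he hc (f := fun i => if i = 2 * k - 2 then k - 2 else i / 2)
    (T := fun p => 2 * k - 2 ≤ p ∨ (p % 2 = 1 ∧ k < p ∧ p + 5 ≤ 2 * k) ∨ (p % 2 = 0 ∧ p + 2 ≤ k))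
    (pt := fun i => if (i % 2 = 0 ∧ 0 < i ∧ i ≤ k) ∨ (i % 2 = 1 ∧ k < i ∧ i + 3 ≤ 2 * k)
      then 1 else 0)
    (K := c (chiVar k hk (2 * k - 2)) + c (chiVar k hk (2 * k - 1)))
    (fun p hp _ => by split_ifs <;> omega)
    (fun p hp hTp q hq hTq h => by split_ifs at h <;> omega) ?_
  · rw [← hpt, dotProduct_eq_top he hk2 hc, chiPoint_chiVar (by omega),
      chiPoint_chiVar (by omega), if_neg (by omega), if_neg (by omega), mul_zero, mul_zero,
      add_zero]
  · intro x hz hne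
    have htop := hz (2 * k - 2) (by omega) (by omega)
    rw [chiEqn_sub_two hk, chiEqn_sub_two hk, if_neg (by omega), if_neg (by omega),
      if_neg (by omega)] at htop
    rw [dotProduct_eq_top he hk2 hc]
    by_cases hs : (x ∘ chiVar k hk) (2 * k - 1) = 0
    · refine absurd (eq_chiPoint (hk := hk) ?_) hne
      have h1 := chiEqn_solve_factors (hz (2 * k - 1) (by omega) (by omega))
        (by rw [hs, if_neg (by omega)])
        (by rw [chiFst_last, if_neg (by omega)])
        (by rw [chiSnd_last hk, if_pos (by omega), chiCompl, if_neg (by omega), add_zero])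
      rw [chiFst_last, chiSnd_last hk] at h1
      have hlow := chiEqn_chain hz (a := 0) (b := k) (by omega) (by omega)
        (fun p h1 h2 h3 => ⟨by omega, by omega, if_neg (by omega), if_pos (by omega)⟩) h1.1
      have hupp := chiEqn_chain hz (a := k + 1) (b := 2 * k - 3) (by omega) (by omega)
        (fun p h1 h2 h3 => ⟨by omega, by omega, if_neg (by omega), if_pos (by omega)⟩) h1.2
      intro p hp
      rcases (by omega : p ≤ k ∨ (k + 1 ≤ p ∧ p ≤ 2 * k - 3) ∨ p = 2 * k - 2 ∨ p = 2 * k - 1) with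
        h | ⟨h, h'⟩ | rfl | rfl
      · exact hlow p (by omega) h
      · exact hupp p h h'
      · rw [hs, hlow 1 (by omega) (by omega), if_neg (by omega)] at htop
        rw [if_neg (by omega)]
        exact add_right_cancel htop
      · rw [hs, if_neg (by omega)]
    · have hs1 := (by decide : ∀ a : ZMod 2, ¬ a = 0 → a = 1) _ hs
      rw [hs1] at htop
      have ht1 := (by decide : ∀ a b : ZMod 2, a + (1 + 1) * b = 0 + (0 + 1) * (0 + 1) → a = 1)
        _ _ htop
      rw [Function.comp_apply] at hs1 ht1
      rw [hs1, ht1, mul_one, mul_one]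

theorem component_top (he : ∀ x, e x = chiChi k hk x) (hk2 : k % 2 = 0)
    (hc : algebraicDegree (componentFunction e.symm c) < k) :
    c (chiVar k hk (2 * k - 2)) = 0 := by
  have hadd := component_top_add he hk2 hc
  have hpt := dotProduct_chiPoint_eq he hc (f := fun i => (i - 1) / 2)
    (T := fun p => 2 * k - 2 ≤ p ∨ p = k ∨ (p % 2 = 1 ∧ p ≠ k - 1 ∧ p + 5 ≤ 2 * k))
    (pt := fun i => if i % 2 = 1 ∧ i ≠ 2 * k - 1 then 1 else 0)
    (K := c (chiVar k hk (2 * k - 2)))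
    (fun p hp _ => by omega) (fun p hp hTp q hq hTq h => by omega) ?_
  · rw [← hpt, dotProduct_eq_top he hk2 hc, chiPoint_chiVar (by omega),
      chiPoint_chiVar (by omega), if_neg (by omega), if_neg (by omega), mul_zero, mul_zero,
      add_zero]
  · intro x hz hne
    have htop := hz (2 * k - 2) (by omega) (by omega)
    rw [chiEqn_sub_two hk, chiEqn_sub_two hk, if_neg (by omega), if_neg (by omega),
      if_pos (by omega)] at htop
    have hprod : ((x ∘ chiVar k hk) (2 * k - 1) + 1) * (x ∘ chiVar k hk) 1 = 0 := by
      by_contra hprod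
      obtain ⟨hs, h1⟩ := (by decide : ∀ a b : ZMod 2, ¬ (a + 1) * b = 0 → a = 0 ∧ b = 1)
        _ _ hprod
      refine hne (eq_chiPoint (hk := hk) ?_)
      have h2 := chiEqn_solve_factors (hz (2 * k - 1) (by omega) (by omega))
        (by rw [hs, if_neg (by omega)])
        (by rw [chiFst_last, if_neg (by omega)])
        (by rw [chiSnd_last hk, if_pos (by omega), chiCompl, if_neg (by omega), add_zero])
      rw [chiFst_last, chiSnd_last hk] at h2
      have hlow := chiEqn_chain hz (a := 1) (b := k - 1) (by omega) (by omega)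
        (fun p h1 h2 h3 => ⟨by omega, by omega, if_neg (by omega), if_pos (by omega)⟩)
        (by rw [h1, if_pos (by omega)])
      have hupp := chiEqn_chain hz (a := k + 1) (b := 2 * k - 3) (by omega) (by omega)
        (fun p h1 h2 h3 => ⟨by omega, by omega, if_neg (by omega), if_pos (by omega)⟩) h2.2
      have ht : (x ∘ chiVar k hk) (2 * k - 2) =
          if (2 * k - 2) % 2 = 1 ∧ 2 * k - 2 ≠ 2 * k - 1 then 1 else 0 := by
        rw [hs, h1] at htop
        rw [if_neg (by omega)]
        exact add_right_cancel htop
      have hk0 := chiEqn_solve_target (hz k (by omega) (by omega))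
        (by rw [chiFst_eq (by omega)]; exact h2.2)
        (by
          rw [chiSnd_eq (by omega) (by omega)]
          rcases (by omega : k + 2 ≤ 2 * k - 3 ∨ k + 2 = 2 * k - 2) with h | h
          · exact hupp _ (by omega) h
          · rw [h]; exact ht)
      intro p hp
      rcases (by omega : p = 0 ∨ (1 ≤ p ∧ p ≤ k - 1) ∨ p = k ∨ (k + 1 ≤ p ∧ p ≤ 2 * k - 3) ∨
        p = 2 * k - 2 ∨ p = 2 * k - 1) with rfl | ⟨h, h'⟩ | rfl | ⟨h, h'⟩ | rfl | rfl
      · exact h2.1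
      · exact hlow p h h'
      · exact hk0
      · exact hupp p h h'
      · exact ht
      · rw [hs, if_neg (by omega)]
    rw [dotProduct_eq_top he hk2 hc]
    exact (by decide : ∀ a b s t r : ZMod 2, a + b = 0 → (s + 1) * r = 0 →
      t + (s + 1) * (r + 1) = 0 + (0 + 1) * (1 + 1) → a * t + b * s = a) _ _ _ _ _ hadd hprod htop

end Families

theorem mainTheorem8 (k : ℕ) (hk : 4 ≤ k) (hk_even : Even k) :
    ∃ e : Equiv.Perm (Fin (2 * k) → ZMod 2),
      (∀ x, e x = chiChi k hk x) ∧
      ∀ c : Fin (2 * k) → ZMod 2, c ≠ 0 →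
        algebraicDegree (componentFunction e.symm c) = k := by
  let e : Equiv.Perm (Fin (2 * k) → ZMod 2) :=
    Equiv.ofBijective (chiChi k hk) (Finite.injective_iff_bijective.1 (chiChi_injective hk_even))
  have he : ∀ x, e x = chiChi k hk x := fun _ => rfl
  have hk2 : k % 2 = 0 := Nat.even_iff.1 hk_even
  refine ⟨e, he, fun c hc0 => le_antisymm ?_ (not_lt.1 fun hc => hc0 ?_)⟩
  · choose P hP hPe using exists_chiChi_polynomial (hk := hk)
    exact algebraicDegree_component_symm_le e P hP (fun x i => hPe i x) c
  · have h1 := component_top he hk2 hc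
    have h2 := component_top_add he hk2 hc
    rw [h1, zero_add] at h2
    refine dotProduct_eq_zero c fun x => ?_
    rw [dotProduct_eq_top he hk2 hc, h1, h2, zero_mul, zero_mul, add_zero]
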